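/- **Setting.** A *rule* is a formula $\forall\bar x\,\forall\bar y\,(\varphi(\bar x,\bar y)\to\exists\bar z\,\psi(\bar x,\bar z))$ whose body $\varphi$ is a finite conjunction of atoms and whose head $\psi$ is a single atom, over constants and variables; $\bar z$ are the $\exists$-variables, and different rules share no $\exists$-variable. A *database* is a finite set of atoms over constants. Facts are atoms over constants and labelled nulls. A homomorphism fixes every constant. Let $\Sigma$ be a finite set of rules. The positions $p[i]$ *invaded* by an $\exists$-variable $y$ form the least set such that a head position of a rule of $\Sigma$ is invaded by $y$ if it holds $y$, or if it holds a $\forall$-variable that occurs in the body of that rule only in positions invaded by $y$. A body variable $x$ of a rule is *attacked* by $y$ if it occurs in the body only in positions invaded by $y$, and *protected* if it is attacked by no $\exists$-variable. $\Sigma$ is *Shy* if for every rule in it: (i) every variable occurring in more than one body atom is protected; (ii) two distinct $\forall$-variables that are not protected but occur both in the head and in two different body atoms are not attacked by the same $\exists$-variable. A rule $\sigma$ is *applicable* to a set $I$ of facts with an assignment $\theta$ of its $\forall$-variables if $\theta(\mathrm{body}(\sigma))\subseteq I$; *firing* it generates the fact $\theta'(\mathrm{head}(\sigma))$, where $\theta'$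 extends $\theta$ by sending each $\exists$-variable to its own fresh null (nulls are named by the triple $\sigma$, $\theta$, $\exists$-variable). The *oblivious chase* $\mathrm{ochase}(D,\Sigma)$ is the (possibly infinite) set of facts obtained from $D$ by firing every applicable pair $(\sigma,\theta)$ until a fixpoint. The *isomorphic chase* starts from $D$ and, in any order, fires applicable pairs whose generated fact is isomorphic to no fact already present, adding this fact, until no such firing is left; $\mathrm{ichase}(D,\Sigma)$ denotes any resulting set. Two facts are isomorphic if they have the same predicate and the same constants in the same positions, and a bijection between their nulls turns one into the other. A Boolean atomic query $q$ is an atom over constants and (existentially quantified) variables; $I\models q$ means that some homomorphism maps $q$ to a fact in $I$. **Theorem (Boolean atomic query answering with the isomorphic chase over Shy).** Let $\Sigma$ be a Shy finite set of rules and $D$ a database. Every sequence of isomorphic chase steps from $D$ is finite, so that $\mathrm{ichase}(D,\Sigma)$ exists; and for every result $\mathrm{ichase}(D,\Sigma)$ of the isomorphic chase and every Boolean atomic query $q$, $$\mathrm{ochase}(D,\Sigma)\models q\quad\text{if and only if}\quad \mathrm{ichase}(D,\Sigma)\models q .$$ -/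

import Mathlib

/-!
Existential rules with one head atom, the Shy fragment, the oblivious chase and the isomorphic
chase.  Throughout, `P` is the set of predicates, `ar` gives their arities, `C` is the set of
constants and `V` the set of variables.
-/

/-- An atom `p(t₁, …, tₖ)`, `k = ar p`, with arguments of kind `T`. -/
structure Atom {P : Type*} (ar : P → ℕ) (T : Type*) where
  pred : P
  args : Fin (ar pred) → T

namespace Atom

/-- Apply `f` to every argument of an atom. -/
def map {P : Type*} {ar : P → ℕ} {T U : Type*} (f : T → U) (a : Atom ar T) : Atom ar U :=
  ⟨a.pred, fun i => f (a.args i)⟩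

end Atom

/-- The terms of rules and queries: constants and variables. -/
inductive RTerm (C V : Type*) where
  | const (c : C)
  | var (x : V)

/-- The set of variables of an atom. -/
def Atom.vars {P : Type*} {ar : P → ℕ} {C V : Type*} (a : Atom ar (RTerm C V)) : Set V :=
  {x | ∃ i, a.args i = RTerm.var x}

/-- A rule `∀ x̄ ȳ, φ(x̄, ȳ) → ∃ z̄, ψ(x̄, z̄)`: the body `φ` is a finite set of atoms (read as
their conjunction) and the head `ψ` is an atom.  The `∀`-variables are those of the body, the
`∃`-variables those of the head that are not in the body. -/
structure ExRule {P : Type*} (ar : P → ℕ) (C V : Type*) where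
  body : Finset (Atom ar (RTerm C V))
  head : Atom ar (RTerm C V)

namespace ExRule

/-- The variables of the body, that is, the universally quantified variables of the rule. -/
def bodyVars {P : Type*} {ar : P → ℕ} {C V : Type*} (σ : ExRule ar C V) : Set V :=
  {x | ∃ a ∈ σ.body, x ∈ a.vars}

/-- The existentially quantified variables of the rule. -/
def exVars {P : Type*} {ar : P → ℕ} {C V : Type*} (σ : ExRule ar C V) : Set V :=
  {x | x ∈ σ.head.vars ∧ x ∉ σ.bodyVars}

end ExRule

/-! ### Shy sets of rules -/

/-- The position `p[i]`. -/
abbrev Position {P : Type*} (ar : P → ℕ) := (p : P) × Fin (ar p)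

/-- `Invaded S ρ y π`: the position `π` is invaded by the `∃`-variable `y` of the rule `ρ ∈ S`.
An `∃`-variable is always named together with its rule, so that different rules share none.
The invaded positions are the least ones such that the head position of `y` in `ρ` is invaded,
and so is every head position of a `∀`-variable that occurs in the body only in invaded
positions. -/
inductive Invaded {P : Type*} {ar : P → ℕ} {C V : Type*} (S : Finset (ExRule ar C V))
    (ρ : ExRule ar C V) (y : V) : Position ar → Prop
  | exists_var (hρ : ρ ∈ S) (hy : y ∈ ρ.exVars) (i : Fin (ar ρ.head.pred))
      (hi : ρ.head.args i = RTerm.var y) : Invaded S ρ y ⟨ρ.head.pred, i⟩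
  | forall_var (σ : ExRule ar C V) (hσ : σ ∈ S) (x : V) (hx : x ∈ σ.bodyVars)
      (i : Fin (ar σ.head.pred)) (hi : σ.head.args i = RTerm.var x)
      (hb : ∀ a ∈ σ.body, ∀ j, a.args j = RTerm.var x → Invaded S ρ y ⟨a.pred, j⟩) :
      Invaded S ρ y ⟨σ.head.pred, i⟩

/-- The body variable `x` of `σ` is attacked in `body(σ)` by the `∃`-variable `y` of `ρ`: it
occurs in the body of `σ` only in positions invaded by `y`. -/
def Attacked {P : Type*} {ar : P → ℕ} {C V : Type*} (S : Finset (ExRule ar C V))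
    (σ : ExRule ar C V) (x : V) (ρ : ExRule ar C V) (y : V) : Prop :=
  x ∈ σ.bodyVars ∧
    ∀ a ∈ σ.body, ∀ j, a.args j = RTerm.var x → Invaded S ρ y ⟨a.pred, j⟩

/-- The variable `x` is protected in `body(σ)`: no `∃`-variable attacks it. -/
def Protected {P : Type*} {ar : P → ℕ} {C V : Type*} (S : Finset (ExRule ar C V))
    (σ : ExRule ar C V) (x : V) : Prop :=
  ¬ ∃ ρ y, Attacked S σ x ρ y

/-- `S` is Shy: in every rule, (i) a variable that occurs in more than one body atom is protected
in the body; (ii) two distinct `∀`-variables that are not protected in the body but occur both in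
the head and in two different body atoms are not attacked by the same `∃`-variable. -/
def Shy {P : Type*} {ar : P → ℕ} {C V : Type*} (S : Finset (ExRule ar C V)) : Prop :=
  ∀ σ ∈ S,
    (∀ x, (∃ a ∈ σ.body, ∃ b ∈ σ.body, a ≠ b ∧ x ∈ a.vars ∧ x ∈ b.vars) → Protected S σ x) ∧
    (∀ x₁ x₂, x₁ ≠ x₂ → ¬ Protected S σ x₁ → ¬ Protected S σ x₂ →
      x₁ ∈ σ.head.vars → x₂ ∈ σ.head.vars →
      (∃ a ∈ σ.body, ∃ b ∈ σ.body, a ≠ b ∧ x₁ ∈ a.vars ∧ x₂ ∈ b.vars) →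
      ¬ ∃ ρ y, Attacked S σ x₁ ρ y ∧ Attacked S σ x₂ ρ y)

/-! ### Facts and chase steps -/

/-- The terms of facts: constants and labelled nulls.  The null `null σ θ z` is the one invented
for the `∃`-variable `z` when the rule `σ` fires with the assignment `θ` of its `∀`-variables; so
different firings, and different `∃`-variables, have different nulls. -/
inductive GTerm {P : Type*} (ar : P → ℕ) (C V : Type*) where
  | const (c : C)
  | null (σ : ExRule ar C V) (θ : {x // x ∈ σ.bodyVars} → GTerm ar C V) (z : V)

/-- A fact: an atom over constants and nulls. -/
abbrev GFact {P : Type*} (ar : P → ℕ) (C V : Type*) := Atom ar (GTerm ar C V)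

/-- The facts of a database; a database is a finite set of atoms over constants. -/
def dbFacts {P : Type*} {ar : P → ℕ} {C : Type*} (V : Type*) (D : Finset (Atom ar C)) :
    Set (GFact ar C V) :=
  {f | ∃ a ∈ D, f = a.map GTerm.const}

open Classical in
/-- The extension of an assignment `θ` of the `∀`-variables of `σ` to all terms: constants are
fixed and each `∃`-variable goes to its own new null. -/
noncomputable def ExRule.ext {P : Type*} {ar : P → ℕ} {C V : Type*} (σ : ExRule ar C V)
    (θ : {x // x ∈ σ.bodyVars} → GTerm ar C V) : RTerm C V → GTerm ar C V
  | RTerm.const c => GTerm.const c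
  | RTerm.var x => if h : x ∈ σ.bodyVars then θ ⟨x, h⟩ else GTerm.null σ θ x

/-- The rule `σ` is applicable to `I` with `θ`: `θ(body(σ)) ⊆ I`. -/
def ExRule.Applicable {P : Type*} {ar : P → ℕ} {C V : Type*} (σ : ExRule ar C V)
    (θ : {x // x ∈ σ.bodyVars} → GTerm ar C V) (I : Set (GFact ar C V)) : Prop :=
  ∀ a ∈ σ.body, a.map (σ.ext θ) ∈ I

/-- The fact generated by firing `σ` with `θ`. -/
noncomputable def ExRule.result {P : Type*} {ar : P → ℕ} {C V : Type*} (σ : ExRule ar C V)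
    (θ : {x // x ∈ σ.bodyVars} → GTerm ar C V) : GFact ar C V :=
  σ.head.map (σ.ext θ)

/-! ### The oblivious chase -/

/-- Membership in the oblivious chase: start from the database and fire every applicable
rule and assignment, unconditionally. -/
inductive OChaseMem {P : Type*} {ar : P → ℕ} {C V : Type*} (D : Finset (Atom ar C))
    (S : Finset (ExRule ar C V)) : GFact ar C V → Prop
  | db (a : Atom ar C) (ha : a ∈ D) : OChaseMem D S (a.map GTerm.const)
  | fire (σ : ExRule ar C V) (hσ : σ ∈ S) (θ : {x // x ∈ σ.bodyVars} → GTerm ar C V)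
      (hb : ∀ a ∈ σ.body, OChaseMem D S (a.map (σ.ext θ))) : OChaseMem D S (σ.result θ)

/-- The oblivious chase `ochase(D, S)`. -/
def ochase {P : Type*} {ar : P → ℕ} {C V : Type*} (D : Finset (Atom ar C))
    (S : Finset (ExRule ar C V)) : Set (GFact ar C V) :=
  {f | OChaseMem D S f}

/-! ### The isomorphic chase -/

/-- `h` is a homomorphism from the fact `a` to the fact `b`: it fixes the constants and maps `a`
to `b`. -/
def IsFactHom {P : Type*} {ar : P → ℕ} {C V : Type*} (h : GTerm ar C V → GTerm ar C V)
    (a b : GFact ar C V) : Prop :=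
  (∀ c, h (GTerm.const c) = GTerm.const c) ∧ a.map h = b

/-- Two facts are isomorphic: there are homomorphisms in both directions which, on the terms of
the two facts, are inverse to each other.  Equivalently, the facts have the same predicate and the
same constants in the same positions, and a bijection between their nulls turns one into the
other. -/
def Isomorphic {P : Type*} {ar : P → ℕ} {C V : Type*} (a b : GFact ar C V) : Prop :=
  ∃ h g, IsFactHom h a b ∧ IsFactHom g b a ∧
    (∀ i, g (h (a.args i)) = a.args i) ∧ (∀ i, h (g (b.args i)) = b.args i)

/-- One step of the isomorphic chase: some rule is applicable to `I`, the fact that it generates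
is isomorphic to no fact of `I`, and this fact is added to `I`.  (A firing is never repeated, since
its fact would be isomorphic to itself; so the nulls of a step are always fresh.) -/
def IStep {P : Type*} {ar : P → ℕ} {C V : Type*} (S : Finset (ExRule ar C V))
    (I I' : Set (GFact ar C V)) : Prop :=
  ∃ σ ∈ S, ∃ θ, σ.Applicable θ I ∧ (¬ ∃ b ∈ I, Isomorphic (σ.result θ) b) ∧
    I' = insert (σ.result θ) I

/-- `J` is a result of the isomorphic chase of `D` with `S`: it is reached from `D` by finitely
many steps, in some order, and no further step is possible. -/
def IsIChase {P : Type*} {ar : P → ℕ} {C V : Type*} (D : Finset (Atom ar C))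
    (S : Finset (ExRule ar C V)) (J : Set (GFact ar C V)) : Prop :=
  Relation.ReflTransGen (IStep S) (dbFacts V D) J ∧ ∀ J', ¬ IStep S J J'

/-! ### Boolean atomic queries -/

/-- Apply an assignment of the variables to a term of a query. -/
def RTerm.eval {P : Type*} {ar : P → ℕ} {C V : Type*} (h : V → GTerm ar C V) :
    RTerm C V → GTerm ar C V
  | RTerm.const c => GTerm.const c
  | RTerm.var x => h x

/-- `I ⊨ q` for the Boolean atomic query `q`, whose variables are existentially quantified: some
homomorphism maps `q` into `I`. -/
def Entails {P : Type*} {ar : P → ℕ} {C V : Type*} (I : Set (GFact ar C V))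
    (q : Atom ar (RTerm C V)) : Prop :=
  ∃ h : V → GTerm ar C V, q.map (RTerm.eval h) ∈ I

/-! A null records the firing that invents it, so every isomorphic chase step is also an oblivious
firing. Hence J ⊆ `ochase D S` for every result J, and queries transfer from J at once. Conversely,
it suffices that each oblivious fact has an isomorphic copy in J (`IsIChase.exists_isomorphic`).

This goes by induction on the derivation. The body facts have copies in J, but each copy brings its
own renaming of nulls, and these must be glued into one assignment (`Shy.exists_isomorphic_firing`).
By `OChaseMem.invaded`, a variable that holds a null is attacked. So Shy (i) forces variables shared
by body atoms to hold constants, which all renamings fix, and Shy (ii) forbids head variables from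
different atoms to hold the same null. The glued assignment thus keeps the equality pattern of the
head. Since no step is possible from J, it already contains a copy of the generated fact.

Termination is a count: finitely many predicates and constants give finitely many isomorphism types
(`exists_isomorphic_of_seq`), and each step adds a new one. -/

/-! ### Isomorphism of facts as equality of patterns. -/

section Isomorphism

variable {P : Type*} {ar : P → ℕ} {C V : Type*}

/-- Facts with the same predicate, the same constants in the same positions and the same equalities
between their terms are isomorphic. -/
theorem Isomorphic.of_pattern {p : P} {f g : Fin (ar p) → GTerm ar C V}
    (heq : ∀ i j, f i = f j ↔ g i = g j)
    (hc : ∀ i c, f i = GTerm.const c ↔ g i = GTerm.const c) :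
    Isomorphic (⟨p, f⟩ : GFact ar C V) ⟨p, g⟩ := by
  classical
  have key : ∀ f g : Fin (ar p) → GTerm ar C V, (∀ i j, f i = f j ↔ g i = g j) →
      (∀ i c, f i = GTerm.const c ↔ g i = GTerm.const c) →
      ∃ h : GTerm ar C V → GTerm ar C V,
        (∀ c, h (GTerm.const c) = GTerm.const c) ∧ ∀ i, h (f i) = g i := by
    intro f g heq hc
    -- The choice of index is harmless because `heq` makes `g` constant on the fibres of `f`; off
    -- the range of `f` the map is the identity.
    refine ⟨fun t => if h : ∃ i, f i = t then g h.choose else t, fun c => ?_, fun i => ?_⟩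
    · by_cases h : ∃ i, f i = GTerm.const c
      · simp only [h, dite_true]
        exact (hc _ _).1 h.choose_spec
      · simp [h]
    · have h : ∃ j, f j = f i := ⟨i, rfl⟩
      simp only [h, dite_true]
      exact (heq _ _).1 h.choose_spec
  obtain ⟨h, hconst, hfg⟩ := key f g heq hc
  obtain ⟨k, kconst, kgf⟩ := key g f (fun i j => (heq i j).symm) (fun i c => (hc i c).symm)
  refine ⟨h, k, ⟨hconst, ?_⟩, ⟨kconst, ?_⟩, fun i => ?_, fun i => ?_⟩
  · simp only [Atom.map, hfg]
  · simp only [Atom.map, kgf]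
  · simp only [hfg, kgf]
  · simp only [hfg, kgf]

/-- An isomorphism is a homomorphism that is injective on the terms of the fact and sends no null
of it to a constant. -/
theorem Isomorphic.exists_hom {a b : GFact ar C V} (hab : Isomorphic a b) :
    ∃ h : GTerm ar C V → GTerm ar C V, (∀ c, h (GTerm.const c) = GTerm.const c) ∧ a.map h = b ∧
      (∀ i j, h (a.args i) = h (a.args j) → a.args i = a.args j) ∧
      ∀ i c, h (a.args i) = GTerm.const c → a.args i = GTerm.const c := by
  obtain ⟨h, g, ⟨hc, hm⟩, ⟨gc, -⟩, hgh, -⟩ := hab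
  refine ⟨h, hc, hm, fun i j hij => ?_, fun i c hi => ?_⟩
  · rw [← hgh i, hij, hgh j]
  · rw [← hgh i, hi, gc]

theorem Isomorphic.refl (a : GFact ar C V) : Isomorphic a a :=
  ⟨id, id, ⟨fun _ => rfl, rfl⟩, ⟨fun _ => rfl, rfl⟩, fun _ => rfl, fun _ => rfl⟩

theorem Isomorphic.trans {a b c : GFact ar C V} (hab : Isomorphic a b) (hbc : Isomorphic b c) :
    Isomorphic a c := by
  obtain ⟨h, hh, rfl, inj, cst⟩ := hab.exists_hom
  obtain ⟨k, hk, rfl, inj', cst'⟩ := hbc.exists_hom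
  refine Isomorphic.of_pattern (p := a.pred) (f := a.args) (fun i j => ⟨fun e => ?_, fun e => ?_⟩)
    (fun i c => ⟨fun e => ?_, fun e => ?_⟩)
  · exact congrArg (fun t => k (h t)) e
  · exact inj i j (inj' i j e)
  · change k (h (a.args i)) = _
    rw [e, hh, hk]
  · exact cst i c (cst' i c e)

/-- A query that maps into a fact maps into every isomorphic fact. -/
theorem Entails.of_isomorphic {I J : Set (GFact ar C V)}
    (hIJ : ∀ f ∈ I, ∃ b ∈ J, Isomorphic f b) {q : Atom ar (RTerm C V)} (hq : Entails I q) :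
    Entails J q := by
  obtain ⟨v, hv⟩ := hq
  obtain ⟨b, hb, hiso⟩ := hIJ _ hv
  obtain ⟨h, hc, rfl, -, -⟩ := hiso.exists_hom
  refine ⟨fun x => h (v x), ?_⟩
  convert hb using 1
  simp only [Atom.map, Atom.mk.injEq, heq_eq_eq, true_and]
  funext i
  cases q.args i <;> simp [RTerm.eval, hc]

end Isomorphism

/-! ### Assignments and the facts they generate. -/

section Firing

variable {P : Type*} {ar : P → ℕ} {C V : Type*}

theorem ExRule.ext_const (σ : ExRule ar C V) (θ : {x // x ∈ σ.bodyVars} → GTerm ar C V) (c : C) :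
    σ.ext θ (RTerm.const c) = GTerm.const c := rfl

theorem ExRule.ext_of_mem (σ : ExRule ar C V) (θ : {x // x ∈ σ.bodyVars} → GTerm ar C V) {x : V}
    (h : x ∈ σ.bodyVars) : σ.ext θ (RTerm.var x) = θ ⟨x, h⟩ := by
  simp [ExRule.ext, h]

theorem ExRule.ext_of_notMem (σ : ExRule ar C V) (θ : {x // x ∈ σ.bodyVars} → GTerm ar C V) {x : V}
    (h : x ∉ σ.bodyVars) : σ.ext θ (RTerm.var x) = GTerm.null σ θ x := by
  simp [ExRule.ext, h]

/-- The nulls of a firing differ from the terms that it is fired with. -/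
theorem GTerm.ne_null_self (σ : ExRule ar C V) (θ : {x // x ∈ σ.bodyVars} → GTerm ar C V) (z : V)
    (x : {x // x ∈ σ.bodyVars}) : θ x ≠ GTerm.null σ θ z := by
  -- No term is its own proper subterm. Naming the null `t` allows structural induction: an equality
  -- for `t` reproduces itself one level down, at `θ x`.
  have key : ∀ t : GTerm ar C V, ∀ (σ : ExRule ar C V) (θ : {x // x ∈ σ.bodyVars} → GTerm ar C V)
      (z : V) (x : {x // x ∈ σ.bodyVars}), t = GTerm.null σ θ z → θ x ≠ t := by
    intro t
    induction t with
    | const c => intro σ θ z x h; cases h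
    | null σ θ z ih =>
      intro σ' θ' z' x h hx
      cases h
      exact ih x σ θ z x hx rfl
  exact key _ σ θ z x rfl

/-- Firings of a rule with assignments that agree on the constants and, for the variables of the
head, on equality, generate isomorphic facts. -/
theorem ExRule.isomorphic_result (σ : ExRule ar C V)
    {θ θ' : {x // x ∈ σ.bodyVars} → GTerm ar C V}
    (hc : ∀ x c, θ x = GTerm.const c ↔ θ' x = GTerm.const c)
    (he : ∀ x y, x.1 ∈ σ.head.vars → y.1 ∈ σ.head.vars → (θ x = θ y ↔ θ' x = θ' y)) :
    Isomorphic (σ.result θ) (σ.result θ') := by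
  have hconst : ∀ t c, σ.ext θ t = GTerm.const c ↔ σ.ext θ' t = GTerm.const c := by
    rintro (d | x) c
    · simp [ExRule.ext_const]
    · by_cases hx : x ∈ σ.bodyVars
      · simp only [ExRule.ext_of_mem _ _ hx, hc]
      · simp [ExRule.ext_of_notMem _ _ hx]
  refine Isomorphic.of_pattern (p := σ.head.pred) (fun i j => ?_) (fun i c => hconst _ c)
  rcases hi : σ.head.args i with c | x
  · rw [ExRule.ext_const, ExRule.ext_const, eq_comm, hconst, eq_comm]
  rcases hj : σ.head.args j with c | y
  · rw [ExRule.ext_const, ExRule.ext_const, hconst]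
  by_cases hx : x ∈ σ.bodyVars <;> by_cases hy : y ∈ σ.bodyVars
  · simp only [ExRule.ext_of_mem _ _ hx, ExRule.ext_of_mem _ _ hy]
    exact he _ _ ⟨i, hi⟩ ⟨j, hj⟩
  · simp only [ExRule.ext_of_mem _ _ hx, ExRule.ext_of_notMem _ _ hy, GTerm.ne_null_self]
  · simp only [ExRule.ext_of_notMem _ _ hx, ExRule.ext_of_mem _ _ hy,
      (GTerm.ne_null_self _ _ _ _).symm]
  · simp [ExRule.ext_of_notMem _ _ hx, ExRule.ext_of_notMem _ _ hy]

end Firing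

/-! ### Nulls, Shyness and isomorphism types in the oblivious chase. -/

section ObliviousChase

variable {P : Type*} {ar : P → ℕ} {C V : Type*} {D : Finset (Atom ar C)}
  {S : Finset (ExRule ar C V)}

/-- A null invented for an `∃`-variable occurs only in positions invaded by that variable. -/
theorem OChaseMem.invaded {f : GFact ar C V} (hf : OChaseMem D S f) :
    ∀ (i : Fin (ar f.pred)) (ρ : ExRule ar C V) (η : {x // x ∈ ρ.bodyVars} → GTerm ar C V) (y : V),
      f.args i = GTerm.null ρ η y → Invaded S ρ y ⟨f.pred, i⟩ := by
  induction hf with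
  | db a ha => intro i ρ η y h; cases h
  | fire σ hσ θ hb ih =>
    intro i ρ η y h
    change σ.ext θ (σ.head.args i) = _ at h
    rcases hi : σ.head.args i with c | x
    · rw [hi] at h; cases h
    rw [hi] at h
    by_cases hx : x ∈ σ.bodyVars
    · refine Invaded.forall_var σ hσ x hx i hi fun a ha j hj => ih a ha j ρ η y ?_
      change σ.ext θ (a.args j) = _
      rw [hj, h]
    · rw [ExRule.ext_of_notMem _ _ hx] at h
      -- Equality of nulls identifies the firings, so `ρ` is `σ` and `y` is `x`.
      cases h
      exact Invaded.exists_var hσ ⟨⟨i, hi⟩, hx⟩ i hi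

/-- A body variable that is assigned a null is attacked by the `∃`-variable of the null. -/
theorem ExRule.Applicable.attacked {σ : ExRule ar C V}
    {θ : {x // x ∈ σ.bodyVars} → GTerm ar C V} (h : σ.Applicable θ (ochase D S))
    (x : {x // x ∈ σ.bodyVars}) {ρ : ExRule ar C V}
    {η : {x // x ∈ ρ.bodyVars} → GTerm ar C V} {y : V} (hx : θ x = GTerm.null ρ η y) :
    Attacked S σ x.1 ρ y := by
  refine ⟨x.2, fun a ha j hj => (h a ha).invaded j ρ η y ?_⟩
  change σ.ext θ (a.args j) = _
  rw [hj, ExRule.ext_of_mem _ _ x.2, hx]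

/-- In a Shy set of rules, variables of the head from different body atoms are never assigned the
same null. -/
theorem Shy.ne_of_ne_atoms (hS : Shy S) {σ : ExRule ar C V} (hσ : σ ∈ S)
    {θ : {x // x ∈ σ.bodyVars} → GTerm ar C V} (h : σ.Applicable θ (ochase D S))
    {x y : {x // x ∈ σ.bodyVars}} (hxh : x.1 ∈ σ.head.vars) (hyh : y.1 ∈ σ.head.vars)
    {a b : Atom ar (RTerm C V)} (ha : a ∈ σ.body) (hb : b ∈ σ.body) (hab : a ≠ b)
    (hxa : x.1 ∈ a.vars) (hyb : y.1 ∈ b.vars) (hnull : ∀ c, θ x ≠ GTerm.const c) :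
    θ x ≠ θ y := by
  intro hxy
  rcases hx : θ x with c | ⟨ρ, η, z⟩
  · exact hnull c hx
  have ax := h.attacked x hx
  have ay := h.attacked y (hxy ▸ hx)
  -- Condition (i) excludes a single variable in both atoms; condition (ii) then excludes two
  -- distinct ones.
  have hne : x.1 ≠ y.1 := fun e =>
    (hS σ hσ).1 x.1 ⟨a, ha, b, hb, hab, hxa, e ▸ hyb⟩ ⟨ρ, z, ax⟩
  exact (hS σ hσ).2 x.1 y.1 hne (fun p => p ⟨ρ, z, ax⟩) (fun p => p ⟨ρ, z, ay⟩) hxh hyh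
    ⟨a, ha, b, hb, hab, hxa, hyb⟩ ⟨ρ, z, ax, ay⟩

/-- If the facts of the oblivious chase that match the body of a rule of a Shy set are replaced by
isomorphic facts of the oblivious chase, then these match the body as well, and the rule generates
isomorphic facts. -/
theorem Shy.exists_isomorphic_firing (hS : Shy S) {σ : ExRule ar C V} (hσ : σ ∈ S)
    {θ : {x // x ∈ σ.bodyVars} → GTerm ar C V} (h : σ.Applicable θ (ochase D S))
    {J : Set (GFact ar C V)} (hJ : J ⊆ ochase D S)
    (hbody : ∀ a ∈ σ.body, ∃ b ∈ J, Isomorphic (a.map (σ.ext θ)) b) :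
    ∃ θ', σ.Applicable θ' J ∧ Isomorphic (σ.result θ) (σ.result θ') := by
  have hbody' : ∀ a : {a // a ∈ σ.body}, ∃ k : GTerm ar C V → GTerm ar C V,
      (∀ c, k (GTerm.const c) = GTerm.const c) ∧ (a.1.map (σ.ext θ)).map k ∈ J ∧
      (∀ i j, k (σ.ext θ (a.1.args i)) = k (σ.ext θ (a.1.args j)) →
        σ.ext θ (a.1.args i) = σ.ext θ (a.1.args j)) ∧
      ∀ i c, k (σ.ext θ (a.1.args i)) = GTerm.const c →
        σ.ext θ (a.1.args i) = GTerm.const c := by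
    intro a
    obtain ⟨b, hb, hiso⟩ := hbody a.1 a.2
    obtain ⟨k, hk, rfl, inj, cst⟩ := hiso.exists_hom
    exact ⟨k, hk, hb, inj, cst⟩
  choose k kconst kJ kinj kcst using hbody'
  have hat : ∀ x : {x // x ∈ σ.bodyVars}, ∃ a : {a // a ∈ σ.body}, x.1 ∈ a.1.vars := fun x => by
    obtain ⟨a, ha, hx⟩ := x.2
    exact ⟨⟨a, ha⟩, hx⟩
  choose at' hat using hat
  -- Each variable is renamed by the map of one chosen atom containing it; `hext` shows that any
  -- other atom containing it gives the same value.
  let θ' : {x // x ∈ σ.bodyVars} → GTerm ar C V := fun x => k (at' x) (θ x)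
  have hext : ∀ a : {a // a ∈ σ.body}, ∀ x : {x // x ∈ σ.bodyVars}, x.1 ∈ a.1.vars →
      θ' x = k a (θ x) := by
    intro a x hxa
    by_cases e : at' x = a
    · rw [← e]
    · rcases hx : θ x with c | ⟨ρ, η, z⟩
      · simp only [θ', hx, kconst]
      · exact absurd ⟨ρ, z, h.attacked x hx⟩ ((hS σ hσ).1 x.1
          ⟨_, (at' x).2, _, a.2, fun e' => e (Subtype.ext e'), hat x, hxa⟩)
  have hbodyTerm : ∀ a : {a // a ∈ σ.body}, ∀ i,
      σ.ext θ' (a.1.args i) = k a (σ.ext θ (a.1.args i)) := by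
    intro a i
    rcases hi : a.1.args i with c | x
    · simp only [ExRule.ext_const, kconst]
    · have hx : x ∈ σ.bodyVars := ⟨a.1, a.2, i, hi⟩
      rw [ExRule.ext_of_mem _ _ hx, ExRule.ext_of_mem _ _ hx]
      exact hext a ⟨x, hx⟩ ⟨i, hi⟩
  have happ : σ.Applicable θ' J := by
    intro a ha
    convert kJ ⟨a, ha⟩ using 1
    simp only [Atom.map, hbodyTerm ⟨a, ha⟩]
  have hc : ∀ x c, θ x = GTerm.const c ↔ θ' x = GTerm.const c := by
    intro x c
    refine ⟨fun e => by simp only [θ', e, kconst], fun e => ?_⟩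
    obtain ⟨i, hi⟩ := hat x
    have := kcst (at' x) i c
    rw [hi, ExRule.ext_of_mem _ _ x.2] at this
    exact this e
  refine ⟨θ', happ, σ.isomorphic_result hc fun x y hxh hyh => ?_⟩
  by_cases hcx : ∃ c, θ x = GTerm.const c
  · obtain ⟨c, hcx⟩ := hcx
    rw [hcx, (hc x c).1 hcx, eq_comm, hc, eq_comm]
  push Not at hcx
  by_cases e : at' x = at' y
  · refine ⟨fun hxy => ?_, fun hxy => ?_⟩
    · simp only [θ', e, hxy]
    · obtain ⟨i, hi⟩ := hat x
      obtain ⟨j, hj⟩ := e ▸ hat y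
      have := kinj (at' x) i j
      rw [hi, hj, ExRule.ext_of_mem _ _ x.2, ExRule.ext_of_mem _ _ y.2] at this
      refine this (hxy.trans ?_)
      rw [e]
  · have hne : (at' x).1 ≠ (at' y).1 := fun e' => e (Subtype.ext e')
    have h' : σ.Applicable θ' (ochase D S) := fun a ha => hJ (happ a ha)
    -- Equality fails under both assignments. For `θ'` this needs `J ⊆ ochase D S`, so that the
    -- copies also obey the invasion bounds.
    exact iff_of_false
      (hS.ne_of_ne_atoms hσ h hxh hyh (at' x).2 (at' y).2 hne (hat x) (hat y) hcx)
      (hS.ne_of_ne_atoms hσ h' hxh hyh (at' x).2 (at' y).2 hne (hat x) (hat y)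
        fun c e => hcx c ((hc x c).2 e))

/-- The constants of the facts of the oblivious chase are those of the database and of the heads of
the rules. -/
theorem OChaseMem.const_mem {f : GFact ar C V} (hf : OChaseMem D S f) :
    ∀ (i : Fin (ar f.pred)) (c : C), f.args i = GTerm.const c →
      c ∈ (⋃ a ∈ D, Set.range a.args) ∪ ⋃ σ ∈ S, RTerm.const ⁻¹' Set.range σ.head.args := by
  induction hf with
  | db a ha =>
    intro i c h
    cases h
    exact Or.inl (Set.mem_biUnion ha ⟨i, rfl⟩)
  | fire σ hσ θ hb ih =>
    intro i c h
    change σ.ext θ (σ.head.args i) = _ at h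
    rcases hi : σ.head.args i with d | x
    · rw [hi] at h
      cases h
      exact Or.inr (Set.mem_biUnion hσ ⟨i, hi⟩)
    rw [hi] at h
    by_cases hx : x ∈ σ.bodyVars
    · obtain ⟨a, ha, j, hj⟩ := id hx
      refine ih a ha j c ?_
      change σ.ext θ (a.args j) = _
      rw [hj, h]
    · rw [ExRule.ext_of_notMem _ _ hx] at h
      cases h

theorem OChaseMem.pred_mem {f : GFact ar C V} (hf : OChaseMem D S f) :
    f.pred ∈ Atom.pred '' (D : Set (Atom ar C)) ∪ (fun σ => σ.head.pred) '' (S : Set (ExRule ar C V)) := by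
  cases hf with
  | db a ha => exact Or.inl ⟨a, ha, rfl⟩
  | fire σ hσ θ hb => exact Or.inr ⟨σ, hσ, rfl⟩

variable (D S) in
/-- The oblivious chase has only finitely many facts up to isomorphism. -/
theorem exists_isomorphic_of_seq (f : ℕ → GFact ar C V) (hf : ∀ n, f n ∈ ochase D S) :
    ∃ m n, m < n ∧ Isomorphic (f n) (f m) := by
  set K : Set C :=
    (⋃ a ∈ D, Set.range a.args) ∪ ⋃ σ ∈ S, RTerm.const ⁻¹' Set.range σ.head.args
  set Q : Set P :=
    Atom.pred '' (D : Set (Atom ar C)) ∪ (fun σ => σ.head.pred) '' (S : Set (ExRule ar C V))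
  have finK : K.Finite := by
    refine Set.Finite.union (D.finite_toSet.biUnion fun a _ => Set.finite_range _)
      (S.finite_toSet.biUnion fun σ _ => (Set.finite_range _).preimage ?_)
    intro c _ d _ h
    cases h
    rfl
  have finQ : Q.Finite := (D.finite_toSet.image _).union (S.finite_toSet.image _)
  have := finK.to_subtype
  have := finQ.to_subtype
  -- The isomorphism type as an element of a finite type: predicate, equalities between arguments,
  -- and places of the constants from `K`.
  let code : ℕ → Σ p : Q, (Fin (ar p.1) → Fin (ar p.1) → Prop) × (Fin (ar p.1) → K → Prop) :=
    fun n => ⟨⟨(f n).pred, (hf n).pred_mem⟩, fun i j => (f n).args i = (f n).args j,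
      fun i c => (f n).args i = GTerm.const c.1⟩
  have key : ∀ m n, code m = code n → Isomorphic (f n) (f m) := by
    intro m n h
    have hcm := (hf m).const_mem
    have hcn := (hf n).const_mem
    simp only [code] at h
    generalize_proofs hpm hpn at h
    -- The argument types depend on the predicates, so the facts must become variables before their
    -- predicates can be identified.
    generalize f m = a at *
    generalize f n = b at *
    obtain ⟨p, g⟩ := a
    obtain ⟨p', g'⟩ := b
    simp only [Sigma.mk.injEq, Subtype.mk.injEq] at h
    obtain ⟨rfl, h⟩ := h
    simp only [heq_eq_eq, Prod.mk.injEq] at h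
    refine Isomorphic.of_pattern (fun i j => ?_) (fun i c => ⟨fun e => ?_, fun e => ?_⟩)
    · exact (iff_of_eq (congrFun (congrFun h.1 i) j)).symm
    · exact (iff_of_eq (congrFun (congrFun h.2 i) ⟨c, hcn i c e⟩)).2 e
    · exact (iff_of_eq (congrFun (congrFun h.2 i) ⟨c, hcm i c e⟩)).1 e
  obtain ⟨m, n, hne, h⟩ := Finite.exists_ne_map_eq_of_infinite code
  rcases lt_or_gt_of_ne hne with hlt | hlt
  · exact ⟨m, n, hlt, key m n h⟩
  · exact ⟨n, m, hlt, key n m h.symm⟩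

end ObliviousChase

/-! ### Termination and completeness of the isomorphic chase. -/

section IsomorphicChase

variable {P : Type*} {ar : P → ℕ} {C V : Type*} {D : Finset (Atom ar C)}
  {S : Finset (ExRule ar C V)}

theorem dbFacts_subset_ochase : dbFacts V D ⊆ ochase D S := by
  rintro f ⟨a, ha, rfl⟩
  exact OChaseMem.db a ha

theorem IStep.subset_ochase {I I' : Set (GFact ar C V)} (h : IStep S I I')
    (hI : I ⊆ ochase D S) : I' ⊆ ochase D S := by
  obtain ⟨σ, hσ, θ, happ, -, rfl⟩ := h
  exact Set.insert_subset (OChaseMem.fire σ hσ θ fun a ha => hI (happ a ha)) hI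

theorem subset_ochase_of_reflTransGen {J : Set (GFact ar C V)}
    (h : Relation.ReflTransGen (IStep S) (dbFacts V D) J) :
    dbFacts V D ⊆ J ∧ J ⊆ ochase D S := by
  induction h with
  | refl => exact ⟨subset_rfl, dbFacts_subset_ochase⟩
  | tail _ hstep ih =>
    refine ⟨ih.1.trans ?_, hstep.subset_ochase ih.2⟩
    obtain ⟨σ, hσ, θ, -, -, rfl⟩ := hstep
    exact Set.subset_insert _ _

variable (D S) in
/-- Every sequence of isomorphic chase steps is finite. -/
theorem not_exists_infinite_IStep_seq :
    ¬ ∃ I : ℕ → Set (GFact ar C V), I 0 = dbFacts V D ∧ ∀ n, IStep S (I n) (I (n + 1)) := by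
  rintro ⟨I, h0, hstep⟩
  have hsub : ∀ n, I n ⊆ ochase D S := fun n => by
    induction n with
    | zero => exact h0 ▸ dbFacts_subset_ochase
    | succ n ih => exact (hstep n).subset_ochase ih
  have hnew : ∀ n, ∃ f, (¬ ∃ b ∈ I n, Isomorphic f b) ∧ I (n + 1) = insert f (I n) := fun n => by
    obtain ⟨σ, _, θ, _, hiso, e⟩ := hstep n
    exact ⟨_, hiso, e⟩
  choose f hiso hI using hnew
  have hmem : ∀ n, f n ∈ I (n + 1) := fun n => hI n ▸ Set.mem_insert _ _
  have hmono : Monotone I := monotone_nat_of_le_succ fun n => hI n ▸ Set.subset_insert _ _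
  obtain ⟨m, n, hlt, hmn⟩ := exists_isomorphic_of_seq D S f fun n => hsub _ (hmem n)
  -- `m < n` means `m + 1 ≤ n`, so `f m`, added at step `m`, is already in `I n` and blocks `f n`.
  exact hiso n ⟨f m, hmono hlt (hmem m), hmn⟩

-- If every reachable set had a successor, iterating a choice of successors would give an infinite
-- chase sequence.
variable (D S) in
theorem exists_isIChase : ∃ J : Set (GFact ar C V), IsIChase D S J := by
  by_contra hno
  have hnext : ∀ J : {J // Relation.ReflTransGen (IStep S) (dbFacts V D) J},
      ∃ J' : {J // Relation.ReflTransGen (IStep S) (dbFacts V D) J}, IStep S J.1 J'.1 := by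
    intro J
    by_contra h
    exact hno ⟨J.1, J.2, fun J' hJ' => h ⟨⟨J', J.2.tail hJ'⟩, hJ'⟩⟩
  choose next hnext using hnext
  refine not_exists_infinite_IStep_seq D S
    ⟨fun n => (next^[n] ⟨dbFacts V D, Relation.ReflTransGen.refl⟩).1, rfl, fun n => ?_⟩
  simp only [Function.iterate_succ_apply']
  exact hnext _

/-- Every fact of the oblivious chase is isomorphic to a fact of the isomorphic chase. -/
theorem IsIChase.exists_isomorphic (hS : Shy S) {J : Set (GFact ar C V)} (hJ : IsIChase D S J)
    {f : GFact ar C V} (hf : OChaseMem D S f) : ∃ b ∈ J, Isomorphic f b := by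
  obtain ⟨hdb, hsub⟩ := subset_ochase_of_reflTransGen hJ.1
  induction hf with
  | db a ha => exact ⟨_, hdb ⟨a, ha, rfl⟩, Isomorphic.refl _⟩
  | fire σ hσ θ hb ih =>
    obtain ⟨θ', happ, hiso⟩ := hS.exists_isomorphic_firing hσ hb hsub ih
    -- If `J` had no copy of the original fact, it would have none of the fact generated by `θ'`
    -- either, and that firing would be a further step.
    by_contra hno
    refine hJ.2 _ ⟨σ, hσ, θ', happ, ?_, rfl⟩
    rintro ⟨b, hbJ, hb'⟩
    exact hno ⟨b, hbJ, hiso.trans hb'⟩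

end IsomorphicChase

theorem mainTheorem4 {P : Type*} {ar : P → ℕ} {C V : Type*} (S : Finset (ExRule ar C V))
    (hS : Shy S) (D : Finset (Atom ar C)) :
    (¬ ∃ I : ℕ → Set (GFact ar C V), I 0 = dbFacts V D ∧ ∀ n, IStep S (I n) (I (n + 1))) ∧
    (∃ J : Set (GFact ar C V), IsIChase D S J) ∧
    ∀ J : Set (GFact ar C V), IsIChase D S J →
      ∀ q : Atom ar (RTerm C V), Entails (ochase D S) q ↔ Entails J q := by
  refine ⟨not_exists_infinite_IStep_seq D S, exists_isIChase D S, fun J hJ q => ⟨?_, ?_⟩⟩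
  · exact Entails.of_isomorphic fun f hf => hJ.exists_isomorphic hS hf
  · rintro ⟨v, hv⟩
    exact ⟨v, (subset_ochase_of_reflTransGen hJ.1).2 hv⟩
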